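/- **Setting.** Let $G=(V,E)$ be a finite directed multigraph with a source $s$, a sink $t\neq s$, capacities $\nu_e>0$, transit times $\tau_e\ge 0$ and a constant network inflow rate $u_0>0$, and let $E^\infty\subseteq E$ be a set of free arcs. For $E^*\subseteq E'\subseteq E$, the pair $(E',E^*)$ is a *valid configuration* if every node is reachable from $s$ in $E'$, from the head of every arc of $E^*$ there is a path to $t$ in $E'$, and no arc of $E^*$ lies on a directed cycle of $E'$. We assume that $(E,E^\infty)$ is a valid configuration. A *thin flow* for $(E',E^*)$ is a pair of a static $s$-$t$ flow $x'\ge 0$ of value $u_0$ supported on $E'$ and labels $m\in\mathbb R^V$ such that, with $\rho_e=x'_e/\nu_e$ for $e\in E^*$ and $\rho_e=\max\{m_v,x'_e/\nu_e\}$ for $e=vw\in E'\setminus E^*$: $m_s=1$; $m_w\le\rho_e$ for all $e=vw\in E'$ with $w\ne s$; $m_w=\rho_e$ for all $e=vw\in E'$ with $x'_e>0$; and every node is reachable from $s$ by a path of arcs $e=vw\in E'$ with $m_w=\rho_e$. (If $E'$ is acyclic, the last condition just says that $m_w=\min_{e=vw\in E'}\rho_e$ is attained for every $w\neq s$.) For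 $\ell\in\mathbb R^V$ let $E'_\ell=E^\infty\cup\{vw:\ell_w\ge\ell_v+\tau_{vw}\}$ and $E^*_\ell=E^\infty\cup\{vw:\ell_w>\ell_v+\tau_{vw}\}$; $\ell$ is a *feasible labelling* if $(E'_\ell,E^*_\ell)$ is a valid configuration. An *equilibrium trajectory* is a locally absolutely continuous map $\ell:[0,\infty)\to\mathbb R^V$ such that $\ell(\theta)$ is feasible for all $\theta\ge0$ and, for almost every $\theta$, the derivative $\ell'(\theta)$ is the label vector of a thin flow for $(E'_{\ell(\theta)},E^*_{\ell(\theta)})$. **Theorem.** Let $\ell^\circ$ be a feasible labelling for $G$ and $E^\infty$, and let $\lambda$ be the label vector of a thin flow for the configuration $(E,E^\infty)$. Then for every equilibrium trajectory $\ell$ with $\ell(0)=\ell^\circ$ there is a finite $T\ge 0$ such that $\ell'_v(\theta)$ exists and equals $\lambda_v$ for all $v\in V$ and all $\theta\ge T$. -/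

import Mathlib

open Set MeasureTheory

/-- A generalized fluid-queueing network: a finite directed multigraph with vertex set `V` and arc
set `E`, a source and a sink, positive arc capacities, nonnegative transit times, a constant
positive network inflow rate, and a set `free` of free arcs (usually written `E^∞`), which are
treated as active and resetting at all times, whatever the labels are. -/
structure GenNetwork (V E : Type*) where
  tail : E → V
  head : E → V
  source : V
  sink : V
  source_ne_sink : source ≠ sink
  cap : E → ℝ
  cap_pos : ∀ e, 0 < cap e
  transit : E → ℝ
  transit_nonneg : ∀ e, 0 ≤ transit e
  rate : ℝ
  rate_pos : 0 < rate
  free : Set E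

namespace GenNetwork

variable {V E : Type*}

/-- There is a directed path (possibly of length zero) from `u` to `v` using arcs of `A` only. -/
def Reach (N : GenNetwork V E) (A : Set E) (u v : V) : Prop :=
  Relation.ReflTransGen (fun a b => ∃ e ∈ A, N.tail e = a ∧ N.head e = b) u v

/-- The arcs that are active for the labelling `l`. -/
def active (N : GenNetwork V E) (l : V → ℝ) : Set E :=
  {e | e ∈ N.free ∨ l (N.tail e) + N.transit e ≤ l (N.head e)}

/-- The arcs that are resetting (carry a queue, or are free) for the labelling `l`. -/
def resetting (N : GenNetwork V E) (l : V → ℝ) : Set E :=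
  {e | e ∈ N.free ∨ l (N.tail e) + N.transit e < l (N.head e)}

/-- `(A, R)` is a valid configuration (`A` the active, `R` the resetting arcs). -/
structure IsValidConfig (N : GenNetwork V E) (A R : Set E) : Prop where
  subset : R ⊆ A
  /-- every node is reachable from the source along active arcs -/
  reach_source : ∀ v, N.Reach A N.source v
  /-- from the head of every resetting arc there is an active path to the sink -/
  reach_sink : ∀ e ∈ R, N.Reach A (N.head e) N.sink
  /-- no resetting arc lies on a directed cycle of active arcs -/
  no_cycle : ∀ e ∈ R, ¬ N.Reach A (N.head e) (N.tail e)

/-- The set `Ω` of feasible labellings: those that induce a valid configuration. -/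
def IsFeasible (N : GenNetwork V E) (l : V → ℝ) : Prop :=
  N.IsValidConfig (N.active l) (N.resetting l)

/-- `x` is a static source-sink flow of value `N.rate` (nonnegative, conserved). -/
structure IsStaticFlow [Fintype E] [DecidableEq V] (N : GenNetwork V E) (x : E → ℝ) : Prop where
  nonneg : ∀ e, 0 ≤ x e
  balance : ∀ v, (∑ e with N.head e = v, x e) - (∑ e with N.tail e = v, x e) =
    (if v = N.sink then N.rate else 0) - (if v = N.source then N.rate else 0)

open Classical in
/-- The congestion function `ρ_e(m_v, x_e)` of the arc `e = vw`, where `R` is the set of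
resetting arcs. -/
noncomputable def rho (N : GenNetwork V E) (R : Set E) (x : E → ℝ) (m : V → ℝ) (e : E) : ℝ :=
  if e ∈ R then x e / N.cap e else max (m (N.tail e)) (x e / N.cap e)

/-- `(x, m)` is a thin flow with resetting for the configuration `(A, R)`. The label of a node is
the minimum of `ρ` over its incoming active arcs. If `A` has no directed cycle, `tight_path` says
just that each such minimum is attained; in general it says that the attaining arcs connect the
source to every node, so that the nodes on a directed cycle cannot attain their minima merely by
referring to one another. -/
structure IsThinFlow [Fintype E] [DecidableEq V] (N : GenNetwork V E) (A R : Set E)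
    (x : E → ℝ) (m : V → ℝ) : Prop where
  flow : N.IsStaticFlow x
  support : ∀ e, e ∉ A → x e = 0
  source : m N.source = 1
  le_rho : ∀ e ∈ A, N.head e ≠ N.source → m (N.head e) ≤ N.rho R x m e
  eq_rho : ∀ e ∈ A, 0 < x e → m (N.head e) = N.rho R x m e
  tight_path : ∀ v, N.Reach {e | e ∈ A ∧ m (N.head e) = N.rho R x m e} N.source v

/-- `m` solves the thin flow problem for the configuration `(A, R)`. -/
def IsThinFlowLabel [Fintype E] [DecidableEq V] (N : GenNetwork V E) (A R : Set E)
    (m : V → ℝ) : Prop :=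
  ∃ x : E → ℝ, N.IsThinFlow A R x m

/-- `l : [0, ∞) → Ω` is an equilibrium trajectory: it is locally absolutely continuous, and at
almost every time its derivative is the thin flow label vector of the configuration induced by its
current value. (Values of `l` at negative times play no role.) -/
structure IsEquilibriumTrajectory [Fintype E] [DecidableEq V] (N : GenNetwork V E)
    (l : ℝ → V → ℝ) : Prop where
  feasible : ∀ θ, 0 ≤ θ → N.IsFeasible (l θ)
  absCont : ∀ T, 0 ≤ T → ∀ v, AbsolutelyContinuousOnInterval (fun θ => l θ v) 0 T
  deriv_ae : ∀ᵐ θ ∂(volume.restrict (Ioi (0 : ℝ))), ∃ m : V → ℝ,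
    N.IsThinFlowLabel (N.active (l θ)) (N.resetting (l θ)) m ∧
      ∀ v, HasDerivAt (fun ξ => l ξ v) (m v) θ

end GenNetwork

/-! The proof is a Lyapunov argument in which `pot` is an objective dual to the steady state flow.
An arc that is free, or along which `lam` increases, should carry the full flow `cap * lam (head)`.
It contributes a linear term in the scaled labels `l v / lam v`, plus a penalty for inactivity if it
is not free. Every other arc is charged for its queue. Weak duality with the steady flow bounds
`pot` above (`pot_le_and`).

The potential is monotone (`potRate_nonneg_and`). Let `x` be the flow of the current phase and `r v
= m v / lam v`, so that `r = 1` at the source. Testing `x` with `log r` gives `rate * log r(sink) ≤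
rate * (r(sink) - 1)`, while arc by arc `a - b ≤ a * (log a - log b)` bounds `arcRate` by the tested
flow. Equality makes all arcs tight, and then `r ≥ 1` everywhere.

Thin flow labels are unique, so there are only finitely many phases. Hence any rate that is
nonpositive whenever `potRate = 0` is at most a constant times `potRate`. As `pot` is bounded, the
labels neither fall behind the steady motion nor run ahead of it by more than a constant. A multiple
of `pot` plus the sum of `l v / lam v - θ` is then bounded above and nondecreasing, and its rate
vanishes only if `potRate = 0` and `m = lam`; so such a phase occurs (`exists_steady_phase`). In it
the current flow certifies that `pot` is maximal. From then on `pot` is constant, and the same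
estimates, now without error term, force linear motion (`label_eq_of_steady_phase`). -/

/-! ### Derivatives of positive parts and absolutely continuous functions -/

/-- A function is nonzero near, but off, a zero at which its derivative does not vanish; so there
are only countably many such zeros. -/
lemma countable_zeros_hasDerivAt_ne_zero (f : ℝ → ℝ) :
    {x : ℝ | f x = 0 ∧ ∃ d, d ≠ 0 ∧ HasDerivAt f d x}.Countable := by
  refine (HereditarilyLindelofSpace.isLindelof _).countable ?_
  rw [discreteTopology_subtype_iff]
  rintro x ⟨-, d, hd, hfd⟩
  rw [← disjoint_iff, Filter.disjoint_principal_right]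
  filter_upwards [hfd.eventually_ne (c := 0) hd] with z hz hz'
  exact hz hz'.1

lemma HasDerivAt.max_zero_of_pos {f : ℝ → ℝ} {d x : ℝ} (hf : HasDerivAt f d x) (hx : 0 < f x) :
    HasDerivAt (fun y => max (f y) 0) d x := by
  refine hf.congr_of_eventuallyEq ?_
  filter_upwards [hf.continuousAt.eventually (lt_mem_nhds hx)] with y hy
  exact max_eq_left hy.le

/-- At a zero of `f` the derivative vanishes too, and `|max f 0| ≤ |f|` passes the little-o estimate
on. -/
lemma HasDerivAt.max_zero_of_nonpos {f : ℝ → ℝ} {d x : ℝ} (hf : HasDerivAt f d x) (hx : f x ≤ 0)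
    (hd : f x = 0 → d = 0) : HasDerivAt (fun y => max (f y) 0) 0 x := by
  rcases hx.lt_or_eq with hx | hx
  · refine (hasDerivAt_const x (0 : ℝ)).congr_of_eventuallyEq ?_
    filter_upwards [hf.continuousAt.eventually (gt_mem_nhds hx)] with y hy
    exact max_eq_right hy.le
  · have h := hf
    rw [hd hx, hasDerivAt_iff_isLittleO] at h
    rw [hasDerivAt_iff_isLittleO]
    refine Asymptotics.IsBigO.trans_isLittleO (Asymptotics.IsBigO.of_bound 1 ?_) h
    refine Filter.Eventually.of_forall fun y => ?_
    simp only [hx, smul_zero, sub_zero, max_self, Real.norm_eq_abs, one_mul]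
    rcases le_total (f y) 0 with h' | h' <;> simp [h']

lemma AbsolutelyContinuousOnInterval.max_zero {f : ℝ → ℝ} {a b : ℝ}
    (hf : AbsolutelyContinuousOnInterval f a b) :
    AbsolutelyContinuousOnInterval (fun x => max (f x) 0) a b := by
  refine squeeze_zero (fun t => Finset.sum_nonneg fun i _ => dist_nonneg)
    (fun t => Finset.sum_le_sum fun i _ => ?_) hf
  simpa [Real.dist_eq] using abs_max_sub_max_le_abs (f (t.2 i).1) (f (t.2 i).2) 0

lemma AbsolutelyContinuousOnInterval.const_fun (c a b : ℝ) :
    AbsolutelyContinuousOnInterval (fun _ => c) a b :=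
  (contDiff_const (n := 1)).contDiffOn.absolutelyContinuousOnInterval

lemma AbsolutelyContinuousOnInterval.sum {ι : Type*} (s : Finset ι) {f : ι → ℝ → ℝ} {a b : ℝ}
    (hf : ∀ i ∈ s, AbsolutelyContinuousOnInterval (f i) a b) :
    AbsolutelyContinuousOnInterval (fun x => ∑ i ∈ s, f i x) a b := by
  classical
  induction s using Finset.induction_on with
  | empty => simpa using const_fun 0 a b
  | insert i s hi ih =>
    simp only [Finset.sum_insert hi]
    exact (hf i (by simp)).fun_add (ih fun j hj => hf j (by simp [hj]))

lemma AbsolutelyContinuousOnInterval.le_of_ae_deriv_nonneg {f : ℝ → ℝ} {a b : ℝ} (hab : a ≤ b)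
    (hf : AbsolutelyContinuousOnInterval f a b)
    (hd : ∀ᵐ x, a < x → ∃ d, 0 ≤ d ∧ HasDerivAt f d x) : f a ≤ f b := by
  have h := hf.integral_deriv_eq_sub
  have h2 : 0 ≤ ∫ x in a..b, deriv f x := by
    refine intervalIntegral.integral_nonneg_of_ae_restrict hab ?_
    rw [Filter.EventuallyLE, ae_restrict_iff' measurableSet_Icc]
    have h0 : ∀ᵐ x : ℝ, x ≠ a := by simp [ae_iff]
    filter_upwards [hd, h0] with x hx hxa hxI
    obtain ⟨d, h0, hd⟩ := hx (lt_of_le_of_ne hxI.1 (Ne.symm hxa))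
    simpa [hd.deriv] using h0
  linarith

/-! ### Thin flows: positivity and uniqueness of the labels -/

namespace GenNetwork

variable {V E : Type*} {N : GenNetwork V E}

lemma IsValidConfig.head_ne_source {A R : Set E} (hc : N.IsValidConfig A R) {e : E} (he : e ∈ R) :
    N.head e ≠ N.source := fun h => hc.no_cycle e he (h ▸ hc.reach_source _)

lemma reach_of_mem {A : Set E} {e : E} (he : e ∈ A) : N.Reach A (N.tail e) (N.head e) :=
  Relation.ReflTransGen.single ⟨e, he, rfl, rfl⟩

/-- A property that passes from the tail to the head of every arc of `A` is inherited along
paths in `A`. -/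
lemma Reach.induction {A : Set E} {u v : V} (h : N.Reach A u v) {p : V → Prop} (hu : p u)
    (hstep : ∀ e ∈ A, p (N.tail e) → p (N.head e)) : p v := by
  induction h with
  | refl => exact hu
  | tail _ h ih =>
    obtain ⟨e, he, rfl, rfl⟩ := h
    exact hstep e he ih

/-- A path in `A` from a node with `p` to a node without `p` has an arc at which `p` gets lost. -/
lemma Reach.exists_exit {A : Set E} {u v : V} (h : N.Reach A u v) {p : V → Prop} (hu : p u)
    (hv : ¬ p v) : ∃ e ∈ A, p (N.tail e) ∧ ¬ p (N.head e) := by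
  by_contra! hcon
  exact hv (h.induction hu hcon)

lemma rho_of_mem {R : Set E} {x : E → ℝ} {m : V → ℝ} {e : E} (he : e ∈ R) :
    N.rho R x m e = x e / N.cap e := by simp [rho, he]

lemma rho_of_notMem {R : Set E} {x : E → ℝ} {m : V → ℝ} {e : E} (he : e ∉ R) :
    N.rho R x m e = max (m (N.tail e)) (x e / N.cap e) := by simp [rho, he]

lemma div_cap_le_rho (R : Set E) (x : E → ℝ) (m : V → ℝ) (e : E) :
    x e / N.cap e ≤ N.rho R x m e := by
  by_cases he : e ∈ R
  · rw [rho_of_mem he]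
  · rw [rho_of_notMem he]; exact le_max_right _ _

variable [DecidableEq V] [Fintype E]

/-- Flow conservation tested with a node function: below, an indicator, the logarithms of speed
ratios, and the scaled labels. -/
lemma IsStaticFlow.sum_mul_sub [Fintype V] {x : E → ℝ} (hx : N.IsStaticFlow x) (f : V → ℝ) :
    ∑ e, x e * (f (N.head e) - f (N.tail e)) = N.rate * (f N.sink - f N.source) := by
  have key : ∀ g : E → V, ∑ e, x e * f (g e) = ∑ v, (∑ e with g e = v, x e) * f v := by
    intro g
    rw [← Finset.sum_fiberwise Finset.univ g]
    refine Finset.sum_congr rfl fun v _ => ?_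
    rw [Finset.sum_mul]
    refine Finset.sum_congr rfl fun e he => ?_
    rw [(Finset.mem_filter.1 he).2]
  simp only [mul_sub, Finset.sum_sub_distrib, key]
  rw [← Finset.sum_sub_distrib]
  simp only [← sub_mul, hx.balance]
  simp [sub_mul, Finset.sum_sub_distrib]

namespace IsThinFlow

variable {A R : Set E} {x : E → ℝ} {m : V → ℝ}

lemma label_nonneg (h : N.IsThinFlow A R x m) (v : V) : 0 ≤ m v := by
  refine (h.tight_path v).induction (p := fun v => 0 ≤ m v) (by simp [h.source]) ?_
  rintro e ⟨-, he⟩ -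
  rw [he]
  exact (div_nonneg (h.flow.nonneg e) (N.cap_pos e).le).trans (div_cap_le_rho _ _ _ _)

lemma flow_le (h : N.IsThinFlow A R x m) (e : E) : x e ≤ N.cap e * m (N.head e) := by
  rcases (h.flow.nonneg e).eq_or_lt with h0 | h0
  · rw [← h0]; exact mul_nonneg (N.cap_pos e).le (h.label_nonneg _)
  · have heA : e ∈ A := by
      by_contra hA; exact h0.ne' (h.support e hA)
    have := div_cap_le_rho (N := N) R x m e
    rw [← h.eq_rho e heA h0, div_le_iff₀ (N.cap_pos e)] at this
    linarith

lemma flow_eq_of_mem (hc : N.IsValidConfig A R) (h : N.IsThinFlow A R x m) {e : E} (he : e ∈ R) :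
    x e = N.cap e * m (N.head e) := by
  refine (h.flow_le e).antisymm ?_
  have := h.le_rho e (hc.subset he) (hc.head_ne_source he)
  rw [rho_of_mem he, le_div_iff₀ (N.cap_pos e)] at this
  linarith

lemma tail_le_head_of_pos (h : N.IsThinFlow A R x m) {e : E} (heR : e ∉ R) (h0 : 0 < x e) :
    m (N.tail e) ≤ m (N.head e) := by
  have heA : e ∈ A := by
    by_contra hA; exact h0.ne' (h.support e hA)
  rw [h.eq_rho e heA h0, rho_of_notMem heR]
  exact le_max_left _ _

lemma flow_eq_of_tail_lt_head (h : N.IsThinFlow A R x m) {e : E} (heA : e ∈ A) (heR : e ∉ R)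
    (hs : N.head e ≠ N.source) (hlt : m (N.tail e) < m (N.head e)) :
    x e = N.cap e * m (N.head e) := by
  refine (h.flow_le e).antisymm ?_
  have := h.le_rho e heA hs
  rw [rho_of_notMem heR, le_max_iff, le_div_iff₀ (N.cap_pos e)] at this
  rcases this with h | h <;> linarith

/-- Arcs of a tight path to such a node lie on active closed walks through the source, so they are
not resetting and labels cannot drop along them. This handles arcs into the source, where `le_rho`
is not available. -/
lemma one_le_of_reach_source (hc : N.IsValidConfig A R) (h : N.IsThinFlow A R x m) {v : V}
    (hv : N.Reach A v N.source) : 1 ≤ m v := by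
  refine (h.tight_path v).induction (p := fun v => N.Reach A v N.source → 1 ≤ m v)
    (fun _ => h.source.ge) ?_ hv
  rintro e ⟨heA, he⟩ ih hr
  have heR : e ∉ R := fun heR => hc.no_cycle e heR (hr.trans (hc.reach_source _))
  rw [he, rho_of_notMem heR]
  exact (ih ((reach_of_mem heA).trans hr)).trans (le_max_left _ _)

lemma flow_out_eq_zero (h : N.IsThinFlow A R x m) {v : V} (hv : m v = 0) :
    v ≠ N.sink ∧ ∀ e, N.tail e = v → x e = 0 := by
  have hvs : v ≠ N.source := by rintro rfl; linarith [h.source]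
  have hin : ∑ e with N.head e = v, x e = 0 := by
    refine Finset.sum_eq_zero fun e he => ?_
    have := h.flow_le e
    rw [(Finset.mem_filter.1 he).2, hv, mul_zero] at this
    exact this.antisymm (h.flow.nonneg e)
  have hb := h.flow.balance v
  rw [hin, if_neg hvs] at hb
  have hnn : ∀ e ∈ Finset.univ.filter (fun e => N.tail e = v), 0 ≤ x e :=
    fun e _ => h.flow.nonneg e
  have h0 := Finset.sum_nonneg hnn
  have hvt : v ≠ N.sink := by
    intro hvt
    rw [if_pos hvt] at hb
    linarith [N.rate_pos]
  refine ⟨hvt, fun e he => ?_⟩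
  rw [if_neg hvt] at hb
  exact (Finset.sum_eq_zero_iff_of_nonneg hnn).1 (by linarith) e (by simp [he])

/-- Along a tight path a label can drop to zero only at a resetting arc. From its head an active
path leads to the sink; a node with label zero sends out no flow, so zero would spread along this
path to the sink, which must receive flow. -/
lemma label_pos (hc : N.IsValidConfig A R) (h : N.IsThinFlow A R x m) (v : V) : 0 < m v := by
  refine (h.tight_path v).induction (p := fun v => 0 < m v) (by simp [h.source]) ?_
  rintro e ⟨heA, he⟩ hpos
  by_cases heR : e ∈ R
  · refine (h.label_nonneg _).lt_of_ne' fun hzero => ?_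
    refine (h.flow_out_eq_zero (v := N.sink) ?_).1 rfl
    refine (hc.reach_sink e heR).induction (p := fun v => m v = 0) hzero fun f hf hf0 => ?_
    have hx := (h.flow_out_eq_zero hf0).2 f rfl
    by_cases hs : N.head f = N.source
    · have := h.one_le_of_reach_source hc (hs ▸ reach_of_mem hf)
      linarith
    · refine le_antisymm ?_ (h.label_nonneg _)
      refine (h.le_rho f hf hs).trans ?_
      by_cases hfR : f ∈ R
      · simp [rho_of_mem hfR, hx]
      · simp [rho_of_notMem hfR, hx, hf0]
  · rw [he, rho_of_notMem heR]
    exact hpos.trans_le (le_max_left _ _)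

/-- Consider the set of nodes at which `m'` exceeds `m`. In passing from `x` to `x'`, the flow on
entering arcs does not decrease and on leaving arcs does not increase, yet the net flow into the set
is the same; so neither changes. -/
lemma label_le [Fintype V] (hc : N.IsValidConfig A R) {x' : E → ℝ} {m' : V → ℝ}
    (h : N.IsThinFlow A R x m) (h' : N.IsThinFlow A R x' m') (v : V) : m' v ≤ m v := by
  classical
  by_contra! hv
  set f : V → ℝ := fun v => if m v < m' v then 1 else 0 with hf
  have hsrc : ¬ m N.source < m' N.source := by simp [h.source, h'.source]
  have hsum : ∑ e, (x' e - x e) * (f (N.head e) - f (N.tail e)) = 0 := by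
    simp only [sub_mul, Finset.sum_sub_distrib, h.flow.sum_mul_sub, h'.flow.sum_mul_sub, sub_self]
  -- arcs that enter the set of nodes with increased label
  have hin : ∀ e, ¬ m (N.tail e) < m' (N.tail e) → m (N.head e) < m' (N.head e) →
      x e ≤ x' e ∧ (0 < x e → x e < x' e) := by
    intro e ht hh
    suffices 0 < x e → x e < x' e from
      ⟨(h.flow.nonneg e).eq_or_lt.elim (fun h0 => h0 ▸ h'.flow.nonneg e) fun h0 => (this h0).le,
        this⟩
    intro h0
    have heA : e ∈ A := by
      by_contra hA; exact h0.ne' (h.support e hA)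
    have hc0 := N.cap_pos e
    have key : x' e = N.cap e * m' (N.head e) := by
      by_cases heR : e ∈ R
      · exact h'.flow_eq_of_mem hc heR
      · refine h'.flow_eq_of_tail_lt_head heA heR (fun hs => hsrc (hs ▸ hh)) ?_
        linarith [h.tail_le_head_of_pos heR h0]
    rw [key]
    exact (h.flow_le e).trans_lt (mul_lt_mul_of_pos_left hh hc0)
  -- arcs that leave this set
  have hout : ∀ e, m (N.tail e) < m' (N.tail e) → ¬ m (N.head e) < m' (N.head e) →
      x' e ≤ x e := by
    intro e ht hh
    rcases (h'.flow.nonneg e).eq_or_lt with h0 | h0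
    · rw [← h0]; exact h.flow.nonneg e
    have heA : e ∈ A := by
      by_contra hA; exact h0.ne' (h'.support e hA)
    have key : x e = N.cap e * m (N.head e) := by
      by_cases heR : e ∈ R
      · exact h.flow_eq_of_mem hc heR
      · have h1 := h'.tail_le_head_of_pos heR h0
        refine h.flow_eq_of_tail_lt_head heA heR (fun hs => ?_) (by linarith)
        have := h.one_le_of_reach_source hc (hs ▸ reach_of_mem heA)
        rw [hs, h'.source] at h1
        linarith
    rw [key]
    refine (h'.flow_le e).trans (mul_le_mul_of_nonneg_left (not_lt.1 hh) (N.cap_pos e).le)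
  have hterm : ∀ e ∈ Finset.univ, 0 ≤ (x' e - x e) * (f (N.head e) - f (N.tail e)) := by
    intro e _
    by_cases ht : m (N.tail e) < m' (N.tail e) <;> by_cases hh : m (N.head e) < m' (N.head e)
    · simp [hf, ht, hh]
    · simpa [hf, ht, hh] using hout e ht hh
    · simpa [hf, ht, hh] using (hin e ht hh).1
    · simp [hf, ht, hh]
  have hzero := (Finset.sum_eq_zero_iff_of_nonneg hterm).1 hsum
  -- A tight path for `m` enters the set by an arc without flow in `x` or `x'`. There the label of
  -- the tail limits that of the head, unless the arc is resetting and both congestions are zero.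
  obtain ⟨e, ⟨heA, he⟩, ht, hh⟩ :=
    (h.tight_path v).exists_exit (p := fun v => ¬ m v < m' v) hsrc (not_not.2 hv)
  rw [not_not] at hh
  have heq : x' e - x e = 0 := by simpa [hf, ht, hh] using hzero e (Finset.mem_univ e)
  have hx : x e = 0 := by
    by_contra h0
    linarith [(hin e ht hh).2 ((h.flow.nonneg e).lt_of_ne' h0)]
  have hx' : x' e = 0 := by linarith
  have hle := h'.le_rho e heA fun hs => hsrc (hs ▸ hh)
  have : N.rho R x' m' e ≤ N.rho R x m e := by
    by_cases heR : e ∈ R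
    · simp [rho_of_mem heR, hx, hx']
    · simp only [rho_of_notMem heR, hx, hx', zero_div]
      exact max_le_max_right _ (not_lt.1 ht)
  linarith

/-- The labels of a thin flow are determined by the configuration. -/
lemma label_unique [Fintype V] (hc : N.IsValidConfig A R) {x' : E → ℝ} {m' : V → ℝ}
    (h : N.IsThinFlow A R x m) (h' : N.IsThinFlow A R x' m') : m = m' :=
  funext fun v => (h'.label_le hc h v).antisymm (h.label_le hc h' v)

end IsThinFlow

end GenNetwork

/-! ### The logarithmic inequality and a comparison on finite sets -/

/-- This is `log t < t - 1` at `t = b / a ≠ 1`, multiplied by `a`. -/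
lemma Real.sub_lt_mul_log_sub_log {a b : ℝ} (ha : 0 < a) (hb : 0 < b) (hab : a ≠ b) :
    a - b < a * (Real.log a - Real.log b) := by
  have h := Real.log_lt_sub_one_of_pos (div_pos hb ha) fun h => hab ((div_eq_one_iff_eq ha.ne').1 h).symm
  rw [Real.log_div hb.ne' ha.ne'] at h
  have h2 := mul_lt_mul_of_pos_left h ha
  have h3 : a * (b / a - 1) = b - a := by field_simp
  linarith

lemma Real.sub_le_mul_log_sub_log {a b : ℝ} (ha : 0 < a) (hb : 0 < b) :
    a - b ≤ a * (Real.log a - Real.log b) := by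
  rcases eq_or_ne a b with rfl | hab
  · simp
  · exact (Real.sub_lt_mul_log_sub_log ha hb hab).le

/-- On a finite set, a function that is nonpositive wherever the nonnegative function `D` vanishes
is bounded by a multiple of `D`. -/
lemma Set.Finite.exists_le_mul {α : Type*} {s : Set α} (hs : s.Finite) {D G : α → ℝ}
    (hD : ∀ a ∈ s, 0 ≤ D a) (hG : ∀ a ∈ s, D a = 0 → G a ≤ 0) :
    ∃ C, 0 ≤ C ∧ ∀ a ∈ s, G a ≤ C * D a := by
  have hnn : ∀ a ∈ hs.toFinset, 0 ≤ |G a| / D a := fun a ha =>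
    div_nonneg (abs_nonneg _) (hD a (hs.mem_toFinset.1 ha))
  refine ⟨∑ a ∈ hs.toFinset, |G a| / D a, Finset.sum_nonneg hnn, fun a ha => ?_⟩
  rcases (hD a ha).eq_or_lt with h0 | h0
  · rw [← h0, mul_zero]
    exact hG a ha h0.symm
  · calc G a ≤ |G a| / D a * D a := by rw [div_mul_cancel₀ _ h0.ne']; exact le_abs_self _
      _ ≤ _ := mul_le_mul_of_nonneg_right
        (Finset.single_le_sum hnn (hs.mem_toFinset.2 ha)) h0.le

/-! ### The potential, its rate in a phase, and its upper bound -/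

namespace GenNetwork

variable {V E : Type*} {N : GenNetwork V E}

/-- The contribution of the arc `e` to the potential. -/
noncomputable def arcPot (N : GenNetwork V E) (lam : V → ℝ) (e : E) (l : V → ℝ) : ℝ :=
  open Classical in
  if e ∈ N.free ∨ lam (N.tail e) < lam (N.head e) then
    N.cap e * lam (N.head e) * (l (N.head e) / lam (N.head e) - l (N.tail e) / lam (N.tail e)) +
      (if e ∈ N.free then 0 else N.cap e * max (l (N.tail e) + N.transit e - l (N.head e)) 0)
  else N.cap e * max (l (N.head e) - l (N.tail e) - N.transit e) 0

/-- The rate at which `arcPot` changes when the labels move with speed `m` in the configuration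
`(A, R)`. -/
noncomputable def arcRate (N : GenNetwork V E) (lam : V → ℝ) (e : E) (A R : Set E) (m : V → ℝ) :
    ℝ :=
  open Classical in
  if e ∈ N.free ∨ lam (N.tail e) < lam (N.head e) then
    N.cap e * lam (N.head e) * (m (N.head e) / lam (N.head e) - m (N.tail e) / lam (N.tail e)) +
      (if e ∈ A then 0 else N.cap e * (m (N.tail e) - m (N.head e)))
  else if e ∈ R then N.cap e * (m (N.head e) - m (N.tail e)) else 0

/-- A Lyapunov function for equilibrium trajectories, where `lam` is the steady state speed. -/
noncomputable def pot [Fintype E] (N : GenNetwork V E) (lam l : V → ℝ) : ℝ :=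
  N.rate * (l N.sink / lam N.sink - l N.source / lam N.source) - ∑ e, N.arcPot lam e l

/-- The rate at which `pot` changes. -/
noncomputable def potRate [Fintype E] (N : GenNetwork V E) (lam : V → ℝ) (A R : Set E)
    (m : V → ℝ) : ℝ :=
  N.rate * (m N.sink / lam N.sink - m N.source / lam N.source) - ∑ e, N.arcRate lam e A R m

variable [DecidableEq V] [Fintype E]

/-- `m` is a possible speed of an equilibrium trajectory at a generic time at which its
configuration is `(A, R)`: an arc that is about to build up or to lose a queue keeps the travel
time that it has. -/
structure IsPhase (N : GenNetwork V E) (A R : Set E) (m : V → ℝ) : Prop where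
  valid : N.IsValidConfig A R
  free_subset : N.free ⊆ R
  label : N.IsThinFlowLabel A R m
  regular : ∀ e ∈ A, e ∉ R → m (N.head e) = m (N.tail e)

/-- There are finitely many pairs of arc sets, and each determines its labels. This finiteness later
turns sign conditions into linear bounds. -/
lemma finite_setOf_isPhase [Fintype V] (N : GenNetwork V E) :
    {p : (Set E × Set E) × (V → ℝ) | N.IsPhase p.1.1 p.1.2 p.2}.Finite := by
  refine Set.Finite.of_finite_image (f := Prod.fst) (Set.toFinite _) ?_
  rintro ⟨⟨A, R⟩, m⟩ h ⟨⟨A', R'⟩, m'⟩ h' heq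
  obtain ⟨rfl, rfl⟩ := Prod.mk.inj heq
  obtain ⟨x, hx⟩ := h.label
  obtain ⟨x', hx'⟩ := h'.label
  exact congrArg _ (hx.label_unique h.valid hx')

/-- What equality in `arcRate_le` says about the arc `e`. -/
structure IsTightArc (N : GenNetwork V E) (lam : V → ℝ) (A R : Set E) (m : V → ℝ) (e : E) :
    Prop where
  ratio_le : e ∈ A → m (N.tail e) / lam (N.tail e) ≤ m (N.head e) / lam (N.head e)
  ratio_eq : e ∈ R → m (N.head e) / lam (N.head e) = m (N.tail e) / lam (N.tail e)
  le : e ∈ R → e ∉ N.free → lam (N.tail e) ≤ lam (N.head e)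
  mem : lam (N.tail e) < lam (N.head e) → e ∈ R

/-- A resetting arc carries `cap * m (head)`, which turns the claim into `a - b ≤ a * (log a - log
b)` for the two speed ratios, with further slack if `lam` drops along a non-free arc. An inactive
arc carries no flow, and on an active arc without queue `regular` determines which ratio is larger.
-/
lemma arcRate_le_and {A R : Set E} {x : E → ℝ} {m lam : V → ℝ} (hp : N.IsPhase A R m)
    (h : N.IsThinFlow A R x m) (hlam : ∀ v, 0 < lam v) (e : E) :
    N.arcRate lam e A R m ≤ x e * (Real.log (m (N.head e) / lam (N.head e)) -
        Real.log (m (N.tail e) / lam (N.tail e))) ∧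
      (N.arcRate lam e A R m = x e * (Real.log (m (N.head e) / lam (N.head e)) -
        Real.log (m (N.tail e) / lam (N.tail e))) → N.IsTightArc lam A R m e) := by
  classical
  have hc := N.cap_pos e
  have hlw := hlam (N.head e)
  have hlv := hlam (N.tail e)
  have hmw := h.label_pos hp.valid (N.head e)
  have hmv := h.label_pos hp.valid (N.tail e)
  have hRA := @hp.valid.subset e
  have hFR := @hp.free_subset e
  have hxR := fun he => h.flow_eq_of_mem hp.valid (e := e) he
  have hxA := h.support e
  have hxle := h.flow_le e
  have hx0 := h.flow.nonneg e
  have hreg := hp.regular e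
  have hrw := div_pos hmw hlw
  have hrv := div_pos hmv hlv
  have hmw' : m (N.head e) = lam (N.head e) * (m (N.head e) / lam (N.head e)) := by field_simp
  have hmv' : m (N.tail e) = lam (N.tail e) * (m (N.tail e) / lam (N.tail e)) := by field_simp
  rw [arcRate]
  have hkey := Real.sub_le_mul_log_sub_log hrw hrv
  have hkey' := Real.sub_lt_mul_log_sub_log hrw hrv
  have hlog := Real.log_lt_log hrw (y := m (N.tail e) / lam (N.tail e))
  have hlog' := Real.log_le_log hrv (y := m (N.head e) / lam (N.head e))
  suffices H : _ ∧ (_ → (e ∈ A → m (N.tail e) / lam (N.tail e) ≤ m (N.head e) / lam (N.head e)) ∧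
      (e ∈ R → m (N.head e) / lam (N.head e) = m (N.tail e) / lam (N.tail e)) ∧
      (e ∈ R → e ∉ N.free → lam (N.tail e) ≤ lam (N.head e)) ∧
      (lam (N.tail e) < lam (N.head e) → e ∈ R)) from
    ⟨H.1, fun h => ⟨(H.2 h).1, (H.2 h).2.1, (H.2 h).2.2.1, (H.2 h).2.2.2⟩⟩
  -- What remains is about real numbers: `a`, `b` are the speed ratios and `lw`, `lv` the steady
  -- speeds at head and tail, `c` is the capacity and `y` the flow.
  generalize m (N.head e) / lam (N.head e) = a at *
  generalize m (N.tail e) / lam (N.tail e) = b at *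
  generalize m (N.head e) = mw at *
  generalize m (N.tail e) = mv at *
  generalize lam (N.head e) = lw at *
  generalize lam (N.tail e) = lv at *
  generalize N.cap e = c at *
  generalize x e = y at *
  subst hmw' hmv'
  have hk : 0 < c * lw := mul_pos hc hlw
  by_cases hF : e ∈ N.free ∨ lv < lw
  · rw [if_pos hF]
    by_cases hR : e ∈ R
    · rw [if_pos (hRA hR), hxR hR, add_zero, ← mul_assoc, mul_assoc (c * lw) a]
      refine ⟨mul_le_mul_of_nonneg_left hkey hk.le, fun heq => ?_⟩
      have hab : a = b := by
        by_contra hab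
        exact (mul_lt_mul_of_pos_left (hkey' hab) hk).ne heq
      exact ⟨fun _ => hab.ge, fun _ => hab, fun _ hf => (hF.resolve_left hf).le, fun _ => hR⟩
    · have hlt : lv < lw := hF.resolve_left fun hf => hR (hFR hf)
      suffices hs : c * lw * (a - b) + (if e ∈ A then 0 else c * (lv * b - lw * a)) <
          y * (Real.log a - Real.log b) from ⟨hs.le, fun heq => absurd heq hs.ne⟩
      by_cases hA : e ∈ A
      · rw [if_pos hA, add_zero]
        have heq := hreg hA hR
        -- Regularity says `lw * a = lv * b`, so `lv < lw` forces `a < b`. The logarithmic factor is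
        -- then negative, and `y ≤ c * (lw * a)` helps.
        have hab : a < b := by
          by_contra! hab
          have h1 : lv * b ≤ lv * a := mul_le_mul_of_nonneg_left hab hlv.le
          have h2 : lv * a < lw * a := mul_lt_mul_of_pos_right hlt hrw
          linarith
        calc c * lw * (a - b) < c * lw * (a * (Real.log a - Real.log b)) :=
              mul_lt_mul_of_pos_left (hkey' hab.ne) hk
          _ = c * (lw * a) * (Real.log a - Real.log b) := by ring
          _ ≤ _ := mul_le_mul_of_nonpos_right hxle (by linarith [hlog hab])
      · rw [if_neg hA, hxA hA, zero_mul]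
        have : 0 < c * b * (lw - lv) := mul_pos (mul_pos hc hrv) (by linarith)
        linarith
  · rw [if_neg hF]
    obtain ⟨hF, hle⟩ := not_or.1 hF
    by_cases hR : e ∈ R
    · rw [if_pos hR, hxR hR]
      have h1 : c * lw * (a - b) ≤ c * lw * (a * (Real.log a - Real.log b)) :=
        mul_le_mul_of_nonneg_left hkey hk.le
      have h2 : 0 ≤ c * b * (lv - lw) := mul_nonneg (mul_pos hc hrv).le (by linarith)
      refine ⟨by linarith, fun heq => ?_⟩
      have hab : a = b := by
        by_contra hab
        have := mul_lt_mul_of_pos_left (hkey' hab) hk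
        linarith
      have hll : lv = lw := by
        have h3 : c * b * (lv - lw) = 0 := by linarith
        have := (mul_eq_zero.1 h3).resolve_left (mul_pos hc hrv).ne'
        linarith
      exact ⟨fun _ => hab.ge, fun _ => hab, fun _ _ => hll.le, fun _ => hR⟩
    · rw [if_neg hR]
      have hba : e ∈ A → b ≤ a := fun hA => by
        have heq := hreg hA hR
        by_contra! hab
        have h1 : lw * a < lw * b := mul_lt_mul_of_pos_left hab hlw
        have h2 : lw * b ≤ lv * b := mul_le_mul_of_nonneg_right (not_lt.1 hle) hrv.le
        linarith
      refine ⟨?_, fun _ => ⟨hba, fun h => absurd h hR, fun h => absurd h hR,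
        fun h => absurd h hle⟩⟩
      by_cases hA : e ∈ A
      · exact mul_nonneg hx0 (by linarith [hlog' (hba hA)])
      · simp [hxA hA]

/-- The potential is nondecreasing in every phase; if it is constant, then all arcs are tight. -/
lemma potRate_nonneg_and [Fintype V] {A R : Set E} {m lam : V → ℝ} (hp : N.IsPhase A R m)
    (hlam : ∀ v, 0 < lam v) (hs : lam N.source = 1) :
    0 ≤ N.potRate lam A R m ∧ (N.potRate lam A R m = 0 → ∀ e, N.IsTightArc lam A R m e) := by
  obtain ⟨x, h⟩ := hp.label
  have hsum := h.flow.sum_mul_sub fun v => Real.log (m v / lam v)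
  have hterm := fun e => (arcRate_le_and hp h hlam e).1
  have hle := Finset.sum_le_sum fun e (_ : e ∈ Finset.univ) => hterm e
  have hpos := div_pos (h.label_pos hp.valid N.sink) (hlam N.sink)
  have hlog := mul_le_mul_of_nonneg_left (Real.log_le_sub_one_of_pos hpos) N.rate_pos.le
  have hs1 : m N.source / lam N.source = 1 := by simp [h.source, hs]
  rw [hsum] at hle
  simp only [hs1, Real.log_one, sub_zero] at hle
  rw [potRate, hs1]
  refine ⟨by linarith, fun h0 e => (arcRate_le_and hp h hlam e).2 ?_⟩
  refine (Finset.sum_eq_sum_iff_of_le fun e _ => hterm e).1 ?_ e (Finset.mem_univ e)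
  rw [hsum]
  simp only [hs1, Real.log_one, sub_zero]
  linarith

/-- The ratio is 1 at the source and cannot drop along active arcs. -/
lemma IsPhase.one_le_ratio [Fintype V] {A R : Set E} {m lam : V → ℝ} (hp : N.IsPhase A R m)
    (hs : lam N.source = 1) (ht : ∀ e, N.IsTightArc lam A R m e) (v : V) : 1 ≤ m v / lam v := by
  obtain ⟨x, h⟩ := hp.label
  exact (hp.valid.reach_source v).induction (p := fun v => 1 ≤ m v / lam v)
    (by simp [h.source, hs]) fun e he h1 => h1.trans ((ht e).ratio_le he)

/-- An upper bound of the potential, for a flow `z` that is complementary to the order of the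
labels `lam`; it is attained at labellings with which `z` satisfies complementary slackness. -/
lemma pot_le_and [Fintype V] {lam : V → ℝ} (hlam : ∀ v, 0 < lam v) {z : E → ℝ}
    (hz : N.IsStaticFlow z) (hzle : ∀ e, z e ≤ N.cap e * lam (N.head e))
    (hzeq : ∀ e, e ∈ N.free ∨ lam (N.tail e) < lam (N.head e) → z e = N.cap e * lam (N.head e))
    (hz0 : ∀ e, e ∉ N.free → lam (N.head e) < lam (N.tail e) → z e = 0) :
    ∃ B, (∀ l, N.pot lam l ≤ B) ∧ ∀ l, (∀ e, e ∉ N.active l → z e = 0) →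
      (∀ e ∈ N.resetting l, z e = N.cap e * lam (N.head e)) → N.pot lam l = B := by
  classical
  -- The labels cancel in the best case and leave the scaled transit cost of `z`. On arcs that must
  -- be full, the linear terms cancel and nothing is left.
  set b : E → ℝ := fun e => if e ∈ N.free ∨ lam (N.tail e) < lam (N.head e) then 0 else
    z e * (N.transit e / lam (N.head e)) with hb
  have hsum : ∀ l, N.pot lam l = ∑ e, (z e * (l (N.head e) / lam (N.head e) -
      l (N.tail e) / lam (N.tail e)) - N.arcPot lam e l) := fun l => by
    rw [Finset.sum_sub_distrib, hz.sum_mul_sub fun v => l v / lam v, pot]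
  have hterm : ∀ l e, z e * (l (N.head e) / lam (N.head e) - l (N.tail e) / lam (N.tail e)) -
      N.arcPot lam e l ≤ b e ∧ ((e ∉ N.active l → z e = 0) →
      (e ∈ N.resetting l → z e = N.cap e * lam (N.head e)) →
      z e * (l (N.head e) / lam (N.head e) - l (N.tail e) / lam (N.tail e)) -
      N.arcPot lam e l = b e) := by
    intro l e
    have hc := N.cap_pos e
    have hlw := hlam (N.head e)
    have hlv := hlam (N.tail e)
    simp only [hb, arcPot]
    by_cases hF : e ∈ N.free ∨ lam (N.tail e) < lam (N.head e)
    · rw [if_pos hF, if_pos hF, hzeq e hF]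
      by_cases hf : e ∈ N.free
      · simp [hf]
      · rw [if_neg hf]
        have := mul_nonneg hc.le (le_max_right (l (N.tail e) + N.transit e - l (N.head e)) 0)
        refine ⟨by linarith, fun h1 _ => ?_⟩
        have hA : e ∈ N.active l := by
          by_contra hA
          exact (mul_pos hc hlw).ne' (h1 hA)
        rw [max_eq_right (by linarith [hA.resolve_left hf])]
        ring
    · rw [if_neg hF, if_neg hF]
      obtain ⟨hf, hle⟩ := not_or.1 hF
      rcases (not_lt.1 hle).lt_or_eq with hlt | heq
      · rw [hz0 e hf hlt]
        have := mul_nonneg hc.le (le_max_right (l (N.head e) - l (N.tail e) - N.transit e) 0)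
        refine ⟨by linarith, fun _ h2 => ?_⟩
        have hR : e ∉ N.resetting l := fun hR => (mul_pos hc hlw).ne (h2 hR)
        have : ¬ (l (N.tail e) + N.transit e < l (N.head e)) := fun h => hR (Or.inr h)
        rw [max_eq_right (by linarith)]
        ring
      · rw [← heq]
        have hz' : z e / lam (N.head e) ≤ N.cap e := by
          rw [div_le_iff₀ hlw]; exact hzle e
        have h0 : 0 ≤ z e / lam (N.head e) := div_nonneg (hz.nonneg e) hlw.le
        have e1 : z e * (l (N.head e) / lam (N.head e) - l (N.tail e) / lam (N.head e)) =
          z e / lam (N.head e) * (l (N.head e) - l (N.tail e) - N.transit e) +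
          z e * (N.transit e / lam (N.head e)) := by ring
        rw [e1]
        -- For equal steady speeds the claim compares `z / lam * q` with `cap * max q 0`, where `0 ≤
        -- z / lam ≤ cap`.
        set q := l (N.head e) - l (N.tail e) - N.transit e with hq
        constructor
        · have h1 := mul_le_mul_of_nonneg_left (le_max_left q 0) h0
          have h2 := mul_le_mul_of_nonneg_right hz' (le_max_right q 0)
          linarith
        · intro h1 h2
          suffices z e / lam (N.head e) * q = N.cap e * max q 0 by linarith
          rcases lt_trichotomy q 0 with hq0 | hq0 | hq0
          · rw [h1 fun hA => ?_, max_eq_right hq0.le]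
            · simp
            · linarith [hA.resolve_left hf]
          · simp [hq0]
          · rw [h2 (Or.inr (by linarith)), max_eq_left hq0.le, mul_div_cancel_right₀ _ hlw.ne']
  refine ⟨∑ e, b e, fun l => ?_, fun l h1 h2 => ?_⟩
  · rw [hsum]
    exact Finset.sum_le_sum fun e _ => (hterm l e).1
  · rw [hsum]
    exact Finset.sum_congr rfl fun e _ => (hterm l e).2 (h1 e) (h2 e)

/-- The potential is bounded above. -/
lemma exists_forall_pot_le [Fintype V] (hN : N.IsValidConfig univ N.free) {lam : V → ℝ}
    (h : N.IsThinFlowLabel univ N.free lam) : ∃ B, ∀ k, N.pot lam k ≤ B := by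
  obtain ⟨y, hy⟩ := h
  obtain ⟨B, hB, -⟩ := pot_le_and (hy.label_pos hN) hy.flow hy.flow_le
    (fun e he => by
      by_cases hf : e ∈ N.free
      · exact hy.flow_eq_of_mem hN hf
      · have hlt := he.resolve_left hf
        refine hy.flow_eq_of_tail_lt_head (mem_univ e) hf (fun hs => ?_) hlt
        have := hy.one_le_of_reach_source hN (hs ▸ reach_of_mem (mem_univ e))
        rw [hs, hy.source] at hlt
        linarith)
    (fun e hf hlt => by
      by_contra h0
      linarith [hy.tail_le_head_of_pos hf ((hy.flow.nonneg e).lt_of_ne' h0)])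
  exact ⟨B, hB⟩

end GenNetwork

/-! ### Rates of change along an equilibrium trajectory -/

namespace GenNetwork

variable {V E : Type*} {N : GenNetwork V E} [DecidableEq V] [Fintype E]

/-- Along the trajectory `l`, the function `g` is locally absolutely continuous, and it changes at
the rate `G` given by the phase that `l` is in. -/
structure HasPhaseRate (N : GenNetwork V E) (l : ℝ → V → ℝ) (g : ℝ → ℝ)
    (G : Set E → Set E → (V → ℝ) → ℝ) : Prop where
  absCont : ∀ T, 0 ≤ T → AbsolutelyContinuousOnInterval g 0 T
  hasDerivAt : ∀ θ m, N.IsPhase (N.active (l θ)) (N.resetting (l θ)) m →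
    (∀ v, HasDerivAt (fun ξ => l ξ v) (m v) θ) →
      HasDerivAt g (G (N.active (l θ)) (N.resetting (l θ)) m) θ

namespace HasPhaseRate

variable {l : ℝ → V → ℝ} {g h : ℝ → ℝ} {G H : Set E → Set E → (V → ℝ) → ℝ}

lemma add (hg : N.HasPhaseRate l g G) (hh : N.HasPhaseRate l h H) :
    N.HasPhaseRate l (fun θ => g θ + h θ) (fun A R m => G A R m + H A R m) :=
  ⟨fun T hT => (hg.absCont T hT).fun_add (hh.absCont T hT),
    fun θ m hp hd => (hg.hasDerivAt θ m hp hd).fun_add (hh.hasDerivAt θ m hp hd)⟩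

lemma sub (hg : N.HasPhaseRate l g G) (hh : N.HasPhaseRate l h H) :
    N.HasPhaseRate l (fun θ => g θ - h θ) (fun A R m => G A R m - H A R m) :=
  ⟨fun T hT => (hg.absCont T hT).fun_sub (hh.absCont T hT),
    fun θ m hp hd => (hg.hasDerivAt θ m hp hd).fun_sub (hh.hasDerivAt θ m hp hd)⟩

lemma const_mul (c : ℝ) (hg : N.HasPhaseRate l g G) :
    N.HasPhaseRate l (fun θ => c * g θ) (fun A R m => c * G A R m) :=
  ⟨fun T hT => (hg.absCont T hT).const_mul c,
    fun θ m hp hd => (hg.hasDerivAt θ m hp hd).const_mul c⟩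

lemma div_const (c : ℝ) (hg : N.HasPhaseRate l g G) :
    N.HasPhaseRate l (fun θ => g θ / c) (fun A R m => G A R m / c) := by
  simpa only [div_eq_inv_mul] using hg.const_mul c⁻¹

lemma const (N : GenNetwork V E) (l : ℝ → V → ℝ) (c : ℝ) :
    N.HasPhaseRate l (fun _ => c) (fun _ _ _ => 0) :=
  ⟨fun T _ => .const_fun c 0 T, fun θ _ _ _ => hasDerivAt_const θ c⟩

lemma id (N : GenNetwork V E) (l : ℝ → V → ℝ) :
    N.HasPhaseRate l (fun θ => θ) (fun _ _ _ => 1) :=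
  ⟨fun _ _ => (contDiff_id (n := 1)).contDiffOn.absolutelyContinuousOnInterval,
    fun θ _ _ _ => hasDerivAt_id θ⟩

lemma sum {ι : Type*} (s : Finset ι) {g : ι → ℝ → ℝ} {G : ι → Set E → Set E → (V → ℝ) → ℝ}
    (hg : ∀ i, N.HasPhaseRate l (g i) (G i)) :
    N.HasPhaseRate l (fun θ => ∑ i ∈ s, g i θ) (fun A R m => ∑ i ∈ s, G i A R m) :=
  ⟨fun T hT => .sum s fun i _ => (hg i).absCont T hT,
    fun θ m hp hd => HasDerivAt.fun_sum fun i _ => (hg i).hasDerivAt θ m hp hd⟩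

end HasPhaseRate

namespace IsEquilibriumTrajectory

variable {l : ℝ → V → ℝ} (hl : N.IsEquilibriumTrajectory l)
include hl

/-- Only regularity needs an argument: off a null set, the excess `l w - l v - τ` of an arc has zero
derivative wherever it vanishes. -/
lemma ae_isPhase : ∀ᵐ θ : ℝ, 0 < θ → ∃ m, N.IsPhase (N.active (l θ)) (N.resetting (l θ)) m ∧
    ∀ v, HasDerivAt (fun ξ => l ξ v) (m v) θ := by
  have h1 := (ae_restrict_iff' measurableSet_Ioi).1 hl.deriv_ae
  have h2 : ∀ᵐ θ : ℝ, ∀ e : E, ¬ (l θ (N.head e) - (l θ (N.tail e) + N.transit e) = 0 ∧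
      ∃ d, d ≠ 0 ∧ HasDerivAt (fun ξ => l ξ (N.head e) - (l ξ (N.tail e) + N.transit e)) d θ) :=
    ae_all_iff.2 fun e => measure_eq_zero_iff_ae_notMem.1
      ((countable_zeros_hasDerivAt_ne_zero _).measure_zero volume)
  filter_upwards [h1, h2] with θ h1 h2 hθ
  obtain ⟨m, hm, hd⟩ := h1 hθ
  refine ⟨m, ⟨hl.feasible θ hθ.le, fun e he => Or.inl he, hm, fun e heA heR => ?_⟩, hd⟩
  by_contra hne
  have hf : e ∉ N.free := fun hf => heR (Or.inl hf)
  have hle := heA.resolve_left hf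
  have hge : ¬ (l θ (N.tail e) + N.transit e < l θ (N.head e)) := fun h => heR (Or.inr h)
  exact h2 e ⟨by linarith, _, sub_ne_zero.2 hne, (hd _).fun_sub ((hd _).add_const _)⟩

lemma hasPhaseRate_label (v : V) : N.HasPhaseRate l (fun θ => l θ v) (fun _ _ m => m v) :=
  ⟨fun T hT => hl.absCont T hT v, fun _ _ _ hd => hd v⟩

open Classical in
/-- The rate of change of a queue. -/
lemma hasPhaseRate_queue {e : E} (he : e ∉ N.free) :
    N.HasPhaseRate l (fun θ => max (l θ (N.head e) - l θ (N.tail e) - N.transit e) 0)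
      (fun _ R m => if e ∈ R then m (N.head e) - m (N.tail e) else 0) := by
  have h := ((hl.hasPhaseRate_label (N.head e)).sub (hl.hasPhaseRate_label (N.tail e))).sub
    (.const N l (N.transit e))
  refine ⟨fun T hT => (h.absCont T hT).max_zero, fun θ m hp hd => ?_⟩
  have hD := h.hasDerivAt θ m hp hd
  rw [sub_zero] at hD
  have hiff : e ∈ N.resetting (l θ) ↔ l θ (N.tail e) + N.transit e < l θ (N.head e) := by
    simp [resetting, he]
  by_cases hR : e ∈ N.resetting (l θ)
  · rw [if_pos hR]
    exact hD.max_zero_of_pos (by linarith [hiff.1 hR])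
  · rw [if_neg hR]
    refine hD.max_zero_of_nonpos (by linarith [not_lt.1 (hiff.not.1 hR)]) fun h0 => ?_
    rw [hp.regular e (Or.inr (by linarith)) hR, sub_self]

open Classical in
/-- The rate of change of the time by which an arc fails to be active. -/
lemma hasPhaseRate_delay {e : E} (he : e ∉ N.free) :
    N.HasPhaseRate l (fun θ => max (l θ (N.tail e) + N.transit e - l θ (N.head e)) 0)
      (fun A _ m => if e ∈ A then 0 else m (N.tail e) - m (N.head e)) := by
  have h := ((hl.hasPhaseRate_label (N.tail e)).add (.const N l (N.transit e))).sub
    (hl.hasPhaseRate_label (N.head e))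
  refine ⟨fun T hT => (h.absCont T hT).max_zero, fun θ m hp hd => ?_⟩
  have hD := h.hasDerivAt θ m hp hd
  rw [add_zero] at hD
  have hiff : e ∈ N.active (l θ) ↔ l θ (N.tail e) + N.transit e ≤ l θ (N.head e) := by
    simp [active, he]
  by_cases hA : e ∈ N.active (l θ)
  · rw [if_pos hA]
    refine hD.max_zero_of_nonpos (by linarith [hiff.1 hA]) fun h0 => ?_
    rw [hp.regular e hA fun hR => ?_, sub_self]
    linarith [hR.resolve_left he]
  · rw [if_neg hA]
    exact hD.max_zero_of_pos (by linarith [not_le.1 (hiff.not.1 hA)])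

lemma hasPhaseRate_arcPot (lam : V → ℝ) (e : E) :
    N.HasPhaseRate l (fun θ => N.arcPot lam e (l θ)) (N.arcRate lam e) := by
  classical
  have hw := (hl.hasPhaseRate_label (N.head e)).div_const (lam (N.head e))
  have hv := (hl.hasPhaseRate_label (N.tail e)).div_const (lam (N.tail e))
  have hwv := (hw.sub hv).const_mul (N.cap e * lam (N.head e))
  unfold arcPot arcRate
  by_cases hF : e ∈ N.free ∨ lam (N.tail e) < lam (N.head e)
  · by_cases hf : e ∈ N.free
    · simp only [if_pos hF, if_pos hf]
      refine ⟨fun T hT => by simpa using hwv.absCont T hT, fun θ m hp hd => ?_⟩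
      have hA : e ∈ N.active (l θ) := Or.inl hf
      simpa [hA] using hwv.hasDerivAt θ m hp hd
    · simp only [if_pos hF, if_neg hf]
      simpa only [mul_ite, mul_zero] using
        hwv.add ((hl.hasPhaseRate_delay hf).const_mul (N.cap e))
  · simp only [hF, if_false]
    simpa only [mul_ite, mul_zero] using
      (hl.hasPhaseRate_queue (not_or.1 hF).1).const_mul (N.cap e)

lemma hasPhaseRate_pot (lam : V → ℝ) :
    N.HasPhaseRate l (fun θ => N.pot lam (l θ)) (N.potRate lam) :=
  ((((hl.hasPhaseRate_label N.sink).div_const _).sub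
    ((hl.hasPhaseRate_label N.source).div_const _)).const_mul _).sub
      (.sum _ fun e => hl.hasPhaseRate_arcPot lam e)

lemma le_of_hasPhaseRate {g : ℝ → ℝ} {G : Set E → Set E → (V → ℝ) → ℝ}
    (hg : N.HasPhaseRate l g G)
    (hG : ∀ θ m, 0 < θ → N.IsPhase (N.active (l θ)) (N.resetting (l θ)) m →
      (∀ v, HasDerivAt (fun ξ => l ξ v) (m v) θ) →
        0 ≤ G (N.active (l θ)) (N.resetting (l θ)) m)
    {a b : ℝ} (ha : 0 ≤ a) (hab : a ≤ b) : g a ≤ g b := by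
  refine AbsolutelyContinuousOnInterval.le_of_ae_deriv_nonneg hab
    ((hg.absCont b (ha.trans hab)).mono ?_) ?_
  · rw [uIcc_of_le hab, uIcc_of_le (ha.trans hab)]
    exact Icc_subset_Icc_left ha
  · filter_upwards [hl.ae_isPhase] with θ h hθ
    obtain ⟨m, hp, hd⟩ := h (ha.trans_lt hθ)
    exact ⟨_, hG θ m (ha.trans_lt hθ) hp hd, hg.hasDerivAt θ m hp hd⟩

lemma label_source {a b : ℝ} (ha : 0 ≤ a) (hab : a ≤ b) : l b N.source - l a N.source = b - a := by
  have hone : ∀ A R m, N.IsPhase A R m → m N.source = 1 := fun A R m hp => by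
    obtain ⟨x, hx⟩ := hp.label
    exact hx.source
  have h1 := hl.le_of_hasPhaseRate ((HasPhaseRate.id N l).sub (hl.hasPhaseRate_label N.source))
    (fun _ _ _ hp _ => by simp [hone _ _ _ hp]) ha hab
  have h2 := hl.le_of_hasPhaseRate ((hl.hasPhaseRate_label N.source).sub (HasPhaseRate.id N l))
    (fun _ _ _ hp _ => by simp [hone _ _ _ hp]) ha hab
  linarith

/-- A function that does not increase in the phases in which the nondecreasing function `f` is
constant increases at most in proportion to `f`. -/
lemma exists_sub_le_mul_sub [Fintype V] {f g : ℝ → ℝ} {F G : Set E → Set E → (V → ℝ) → ℝ}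
    (hf : N.HasPhaseRate l f F) (hg : N.HasPhaseRate l g G)
    (hF : ∀ A R m, N.IsPhase A R m → 0 ≤ F A R m)
    (hG : ∀ A R m, N.IsPhase A R m → F A R m = 0 → G A R m ≤ 0) :
    ∃ C, 0 ≤ C ∧ (∀ A R m, N.IsPhase A R m → G A R m ≤ C * F A R m) ∧
      ∀ a b, 0 ≤ a → a ≤ b → g b - g a ≤ C * (f b - f a) := by
  obtain ⟨C, hC, h⟩ := N.finite_setOf_isPhase.exists_le_mul
    (D := fun p => F p.1.1 p.1.2 p.2) (G := fun p => G p.1.1 p.1.2 p.2)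
    (fun p hp => hF _ _ _ hp) (fun p hp => hG _ _ _ hp)
  have h' : ∀ A R m, N.IsPhase A R m → G A R m ≤ C * F A R m := fun A R m hp => h ((A, R), m) hp
  refine ⟨C, hC, h', fun a b ha hab => ?_⟩
  have := hl.le_of_hasPhaseRate ((hf.const_mul C).sub hg)
    (fun θ m _ hp _ => sub_nonneg.2 (h' _ _ m hp)) ha hab
  linarith

end IsEquilibriumTrajectory

end GenNetwork

/-! ### Reaching the steady state and staying in it -/

namespace GenNetwork

variable {V E : Type*} {N : GenNetwork V E} [DecidableEq V] [Fintype E] [Fintype V]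

namespace IsEquilibriumTrajectory

variable {l : ℝ → V → ℝ} (hl : N.IsEquilibriumTrajectory l)
include hl

lemma pot_mono {lam : V → ℝ} (hlam : ∀ v, 0 < lam v) (hs : lam N.source = 1) {a b : ℝ}
    (ha : 0 ≤ a) (hab : a ≤ b) : N.pot lam (l a) ≤ N.pot lam (l b) :=
  hl.le_of_hasPhaseRate (hl.hasPhaseRate_pot lam)
    (fun _ _ _ hp _ => (potRate_nonneg_and hp hlam hs).1) ha hab

/-- The difference of the scaled labels along an arc has an upper bound that increases at most in
proportion to the potential, and that is attained while the arc is active. -/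
lemma exists_arc_bound {lam : V → ℝ} (hlam : ∀ v, 0 < lam v) (hs : lam N.source = 1) {e : E}
    (he : e ∈ N.free ∨ lam (N.tail e) ≤ lam (N.head e)) :
    ∃ (g : (V → ℝ) → ℝ) (C : ℝ), 0 ≤ C ∧
      (∀ k : V → ℝ, k (N.head e) / lam (N.head e) - k (N.tail e) / lam (N.tail e) ≤ g k) ∧
      (∀ k, e ∈ N.active k →
        k (N.head e) / lam (N.head e) - k (N.tail e) / lam (N.tail e) = g k) ∧
      ∀ a b, 0 ≤ a → a ≤ b → g (l b) - g (l a) ≤ C * (N.pot lam (l b) - N.pot lam (l a)) := by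
  classical
  have hpot := hl.hasPhaseRate_pot lam
  have hnn := fun A R m (hp : N.IsPhase A R m) => (potRate_nonneg_and hp hlam hs).1
  -- Here tightness makes the arc resetting with equal ratios, so the difference itself serves as
  -- `g`. For equal speeds on a non-free arc, `g` is queue plus transit time, scaled, which is
  -- constant while there is no queue.
  by_cases hF : e ∈ N.free ∨ lam (N.tail e) < lam (N.head e)
  · obtain ⟨C, hC, -, h⟩ := hl.exists_sub_le_mul_sub hpot
      (((hl.hasPhaseRate_label (N.head e)).div_const (lam (N.head e))).sub
        ((hl.hasPhaseRate_label (N.tail e)).div_const (lam (N.tail e)))) hnn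
      (fun A R m hp h0 => by
        have ht := (potRate_nonneg_and hp hlam hs).2 h0 e
        exact (sub_eq_zero.2 (ht.ratio_eq (hF.elim (fun hf => hp.free_subset hf) ht.mem))).le)
    exact ⟨_, C, hC, fun k => le_rfl, fun k _ => rfl, h⟩
  · obtain ⟨hf, hlt⟩ := not_or.1 hF
    have heq : lam (N.tail e) = lam (N.head e) := (he.resolve_left hf).antisymm (not_lt.1 hlt)
    have hlw := hlam (N.head e)
    obtain ⟨C, hC, -, h⟩ := hl.exists_sub_le_mul_sub hpot
      (((hl.hasPhaseRate_queue hf).add (.const N l (N.transit e))).div_const (lam (N.head e))) hnn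
      (fun A R m hp h0 => by
        have ht := (potRate_nonneg_and hp hlam hs).2 h0 e
        split_ifs with hR
        · have := ht.ratio_eq hR
          rw [heq, div_left_inj' hlw.ne'] at this
          simp [this]
        · simp)
    refine ⟨fun k => (max (k (N.head e) - k (N.tail e) - N.transit e) 0 + N.transit e) /
      lam (N.head e), C, hC, fun k => ?_, fun k hk => ?_, h⟩
    · rw [heq, ← sub_div]
      refine div_le_div_of_nonneg_right ?_ hlw.le
      linarith [le_max_left (k (N.head e) - k (N.tail e) - N.transit e) 0]
    · have := hk.resolve_left hf
      simp only [heq, ← sub_div]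
      rw [max_eq_left (by linarith), sub_add_cancel]

/-- The positions relative to the steady state fall at most in proportion to the potential. -/
lemma exists_ratio_bound {lam : V → ℝ} (hlam : ∀ v, 0 < lam v) (hs : lam N.source = 1) (v : V) :
    ∃ C, 0 ≤ C ∧ (∀ A R m, N.IsPhase A R m → 1 - m v / lam v ≤ C * N.potRate lam A R m) ∧
      ∀ a b, 0 ≤ a → a ≤ b →
        (b - l b v / lam v) - (a - l a v / lam v) ≤ C * (N.pot lam (l b) - N.pot lam (l a)) :=
  hl.exists_sub_le_mul_sub (hl.hasPhaseRate_pot lam)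
    ((HasPhaseRate.id N l).sub ((hl.hasPhaseRate_label v).div_const (lam v)))
    (fun _ _ _ hp => (potRate_nonneg_and hp hlam hs).1)
    (fun _ _ _ hp h0 => by
      linarith [hp.one_le_ratio hs (fun e => (potRate_nonneg_and hp hlam hs).2 h0 e) v])

/-- No node runs ahead of its position in the steady state by more than a constant. -/
lemma exists_label_le (hN : N.IsValidConfig univ N.free) {lam : V → ℝ}
    (h : N.IsThinFlowLabel univ N.free lam) (v : V) :
    ∃ K, ∀ θ, 0 ≤ θ → l θ v / lam v - θ ≤ K := by
  obtain ⟨B, hB⟩ := exists_forall_pot_le hN h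
  obtain ⟨y, hy⟩ := h
  have hlam := hy.label_pos hN
  refine (hy.tight_path v).induction (p := fun v => ∃ K, ∀ θ, 0 ≤ θ → l θ v / lam v - θ ≤ K)
    ⟨l 0 N.source, fun θ hθ => ?_⟩ ?_
  · rw [hy.source, div_one]
    linarith [hl.label_source le_rfl hθ]
  · rintro e ⟨-, he⟩ ⟨K, hK⟩
    have he' : e ∈ N.free ∨ lam (N.tail e) ≤ lam (N.head e) := by
      by_cases hf : e ∈ N.free
      · exact Or.inl hf
      · rw [rho_of_notMem hf] at he
        exact Or.inr (he ▸ le_max_left _ _)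
    obtain ⟨g, C, hC, hle, -, hg⟩ := hl.exists_arc_bound hlam hy.source he'
    refine ⟨K + g (l 0) + C * (B - N.pot lam (l 0)), fun θ hθ => ?_⟩
    have h1 := hK θ hθ
    have h2 := hle (l θ)
    have h3 := hg 0 θ le_rfl hθ
    have h4 := mul_le_mul_of_nonneg_left (sub_le_sub_right (hB (l θ)) (N.pot lam (l 0))) hC
    linarith

/-- At some time the trajectory moves in the steady state direction, in a phase that leaves the
potential constant. -/
lemma exists_steady_phase (hN : N.IsValidConfig univ N.free) {lam : V → ℝ}
    (h : N.IsThinFlowLabel univ N.free lam) :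
    ∃ θ, 0 < θ ∧ N.IsPhase (N.active (l θ)) (N.resetting (l θ)) lam ∧
      N.potRate lam (N.active (l θ)) (N.resetting (l θ)) lam = 0 := by
  classical
  obtain ⟨B, hB⟩ := exists_forall_pot_le hN h
  choose K hK using hl.exists_label_le hN h
  obtain ⟨y, hy⟩ := h
  have hlam := hy.label_pos hN
  have hs := hy.source
  choose C hC hCle hCb using hl.exists_ratio_bound hlam hs
  have hnn := fun A R m (hp : N.IsPhase A R m) => (potRate_nonneg_and hp hlam hs).1
  set S := ∑ v, C v with hS
  have hS0 : 0 ≤ S := Finset.sum_nonneg fun v _ => hC v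
  -- The multiple `S` of `potRate` pays for nodes slower than `lam`; the extra 1 leaves `potRate ≤
  -- D`.
  set D : Set E → Set E → (V → ℝ) → ℝ := fun A R m =>
    (S + 1) * N.potRate lam A R m + ∑ v, (m v / lam v - 1) with hD
  have hrate : N.HasPhaseRate l (fun θ => (S + 1) * N.pot lam (l θ) + ∑ v, (l θ v / lam v - θ)) D :=
    ((hl.hasPhaseRate_pot lam).const_mul (S + 1)).add
      (.sum _ fun v => ((hl.hasPhaseRate_label v).div_const _).sub (.id N l))
  have hDge : ∀ A R m, N.IsPhase A R m → N.potRate lam A R m ≤ D A R m := fun A R m hp => by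
    have h1 := Finset.sum_le_sum fun v (_ : v ∈ Finset.univ) => hCle v A R m hp
    rw [← Finset.sum_mul, ← hS] at h1
    have h2 : ∑ v, (m v / lam v - 1) = - ∑ v, (1 - m v / lam v) := by
      rw [← Finset.sum_neg_distrib]
      exact Finset.sum_congr rfl fun v _ => by ring
    simp only [hD, h2]
    linarith
  have hDzero : ∀ A R m, N.IsPhase A R m → D A R m = 0 →
      N.potRate lam A R m = 0 ∧ m = lam := fun A R m hp h0 => by
    have hp0 : N.potRate lam A R m = 0 :=
      ((hDge A R m hp).trans h0.le).antisymm (hnn A R m hp)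
    refine ⟨hp0, funext fun v => ?_⟩
    simp only [hD, hp0, mul_zero, zero_add] at h0
    have h1 := (Finset.sum_eq_zero_iff_of_nonneg fun v _ => sub_nonneg.2
      (hp.one_le_ratio hs ((potRate_nonneg_and hp hlam hs).2 hp0) v)).1 h0 v (Finset.mem_univ v)
    exact (div_eq_one_iff_eq (hlam v).ne').1 (by linarith)
  -- Finiteness gives `1 ≤ M * D` in every phase that is not steady.
  obtain ⟨M, hM0, hM⟩ := N.finite_setOf_isPhase.exists_le_mul
    (D := fun p => D p.1.1 p.1.2 p.2)
    (G := fun p => if N.potRate lam p.1.1 p.1.2 p.2 = 0 ∧ p.2 = lam then 0 else 1)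
    (fun p hp => (hnn _ _ _ hp).trans (hDge _ _ _ hp))
    (fun p hp h0 => by rw [if_pos (hDzero _ _ _ hp h0)])
  by_contra! hcon
  have hgrow := fun θ (hθ : 0 ≤ θ) =>
    hl.le_of_hasPhaseRate ((hrate.const_mul M).sub (.id N l)) (fun ξ m hξ hp _ => by
      have h1 := hM ((_, _), m) hp
      rw [if_neg] at h1
      · exact sub_nonneg.2 h1
      · rintro ⟨h0, rfl⟩
        exact hcon ξ hξ hp h0) le_rfl hθ
  set Q := (S + 1) * B + ∑ v, K v with hQ
  have hbd : ∀ θ, 0 ≤ θ → (S + 1) * N.pot lam (l θ) + ∑ v, (l θ v / lam v - θ) ≤ Q :=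
    fun θ hθ => add_le_add (mul_le_mul_of_nonneg_left (hB _) (by linarith))
      (Finset.sum_le_sum fun v _ => hK v θ hθ)
  set Q₀ := (S + 1) * N.pot lam (l 0) + ∑ v, (l 0 v / lam v - 0)
  have hQ0 : 0 ≤ M * (Q - Q₀) := mul_nonneg hM0 (sub_nonneg.2 (hbd 0 le_rfl))
  -- Without a steady phase, `M` times the bounded quantity grows at least at unit rate; by this
  -- time it would exceed its bound `M * Q`.
  have h1 := hgrow (M * (Q - Q₀) + 1) (by linarith)
  have h2 := mul_le_mul_of_nonneg_left (hbd (M * (Q - Q₀) + 1) (by linarith)) hM0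
  linarith

/-- A phase as in `exists_steady_phase` lasts forever. -/
lemma label_eq_of_steady_phase {lam : V → ℝ} (hlam : ∀ v, 0 < lam v) (hs : lam N.source = 1)
    {θ₀ θ : ℝ} (hθ₀ : 0 ≤ θ₀) (hθ : θ₀ ≤ θ)
    (hp : N.IsPhase (N.active (l θ₀)) (N.resetting (l θ₀)) lam)
    (h0 : N.potRate lam (N.active (l θ₀)) (N.resetting (l θ₀)) lam = 0) (v : V) :
    l θ v = l θ₀ v + lam v * (θ - θ₀) := by
  have ht := (potRate_nonneg_and hp hlam hs).2 h0
  obtain ⟨x, hx⟩ := hp.label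
  have hpot : N.pot lam (l θ) = N.pot lam (l θ₀) := by
    -- The certificate is the flow `x` of the phase at `θ₀`, which is complementary to `lam` by
    -- tightness and to `l θ₀` as a thin flow; so `l θ₀` maximizes `pot`.
    obtain ⟨B, hB, hBeq⟩ := pot_le_and hlam hx.flow hx.flow_le
      (fun e he => hx.flow_eq_of_mem hp.valid
        (he.elim (fun hf => hp.free_subset hf) (ht e).mem))
      (fun e hf hlt => by
        have hR : e ∉ N.resetting (l θ₀) := fun hR => hlt.not_ge ((ht e).le hR hf)
        by_contra h0
        linarith [hx.tail_le_head_of_pos hR ((hx.flow.nonneg e).lt_of_ne' h0)])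
    refine le_antisymm ?_ (hl.pot_mono hlam hs hθ₀ hθ)
    rw [hBeq (l θ₀) hx.support fun e he => hx.flow_eq_of_mem hp.valid he]
    exact hB _
  have hge : l θ₀ v / lam v - θ₀ ≤ l θ v / lam v - θ := by
    obtain ⟨C, -, -, h⟩ := hl.exists_ratio_bound hlam hs v
    have := h θ₀ θ hθ₀ hθ
    rw [hpot, sub_self, mul_zero] at this
    linarith
  have hle : l θ v / lam v - θ ≤ l θ₀ v / lam v - θ₀ := by
    -- Tight arcs are active at `θ₀`, where the bound `g` of `exists_arc_bound` is attained; with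
    -- `pot` constant, `g` cannot increase.
    refine (hx.tight_path v).induction
      (p := fun v => l θ v / lam v - θ ≤ l θ₀ v / lam v - θ₀) ?_ ?_
    · rw [hs, div_one, div_one]
      linarith [hl.label_source hθ₀ hθ]
    · rintro e ⟨heA, he⟩ ih
      have he' : e ∈ N.free ∨ lam (N.tail e) ≤ lam (N.head e) := by
        by_cases hR : e ∈ N.resetting (l θ₀)
        · exact or_iff_not_imp_left.2 ((ht e).le hR)
        · rw [rho_of_notMem hR] at he
          exact Or.inr (he ▸ le_max_left _ _)
      obtain ⟨g, C, -, h1, h2, h3⟩ := hl.exists_arc_bound hlam hs he'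
      have h3 := h3 θ₀ θ hθ₀ hθ
      rw [hpot, sub_self, mul_zero] at h3
      linarith [h1 (l θ), h2 (l θ₀) heA]
  have heq : l θ v / lam v = l θ₀ v / lam v + (θ - θ₀) := by linarith
  rw [div_eq_iff (hlam v).ne', add_mul, div_mul_cancel₀ _ (hlam v).ne'] at heq
  linarith

end IsEquilibriumTrajectory

end GenNetwork

theorem mainTheorem4 {V E : Type*} [Fintype V] [DecidableEq V] [Fintype E]
    (N : GenNetwork V E)
    (hN : N.IsValidConfig Set.univ N.free)
    (l₀ : V → ℝ) (hl₀ : N.IsFeasible l₀)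
    (lam : V → ℝ) (hlam : N.IsThinFlowLabel Set.univ N.free lam)
    (l : ℝ → V → ℝ) (hl : N.IsEquilibriumTrajectory l) (h0 : l 0 = l₀) :
    ∃ T : ℝ, 0 ≤ T ∧ ∀ θ, T ≤ θ → ∀ v, HasDerivAt (fun ξ => l ξ v) (lam v) θ := by
  obtain ⟨θ₀, hθ₀, hp, hrate⟩ := hl.exists_steady_phase hN hlam
  obtain ⟨y, hy⟩ := hlam
  -- The motion is known only from `θ₀` on, so a two-sided derivative needs `θ > θ₀`.
  refine ⟨θ₀ + 1, by linarith, fun θ hθ v => ?_⟩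
  have hlin : HasDerivAt (fun ξ => l θ₀ v + lam v * (ξ - θ₀)) (lam v) θ := by
    simpa using (((hasDerivAt_id θ).sub_const θ₀).const_mul (lam v)).const_add (l θ₀ v)
  refine hlin.congr_of_eventuallyEq ?_
  filter_upwards [lt_mem_nhds (show θ₀ < θ by linarith)] with ξ hξ
  exact hl.label_eq_of_steady_phase (hy.label_pos hN) hy.source hθ₀.le hξ.le hp hrate v
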